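/- Let $E$ be a finite set and let $P=\{p_1,p_2,\dots\}$. Let $\mathrm{Super}(L^-)$ be the exterior algebra of the free $\mathbb{Z}$-module with basis $E$. Let $\mathrm{Super}(P^+)$ be the divided power algebra over $\mathbb{Z}$ generated by symbols $p^{(k)}$ ($p\in P$, $k\ge 0$) with relations $p^{(j)}p^{(k)}=\binom{j+k}{k}p^{(j+k)}$, $p^{(j)}q^{(k)}=q^{(k)}p^{(j)}$, $p^{(0)}=1$, with coproduct $\delta(p^{(k)})=\sum_{i+j=k}p^{(i)}\otimes p^{(j)}$. Let $\mathrm{Super}(L^-|P^+)$ be the exterior algebra of the free $\mathbb{Z}$-module with basis the symbols $(e|p)$, $e\in E$, $p\in P$. The Laplace pairing $(w,q)\mapsto (w|q)$ is the bilinear map $\mathrm{Super}(L^-)\times\mathrm{Super}(P^+)\to\mathrm{Super}(L^-|P^+)$ determined by $(1|1)=1$, by $(e|p^{(1)})=(e|p)$, by $(w|q)=0$ if $w,q$ are homogeneous of different degrees, and by $(ww'|q)=\sum (w|q_{(1)})(w'|q_{(2)})$, where $\delta(q)=\sum q_{(1)}\otimes q_{(2)}$. Let $M$ be a matroid on $E$.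 A word $w=e_{1}\cdots e_{k}$ in elements of $E$ is dependent if $\{e_1,\dots,e_k\}$ is a dependent set of $M$. The Whitney module $W(M)$ is the quotient of $\mathrm{Super}(L^-|P^+)$ by the two-sided ideal generated by all $(w|p_1^{(\alpha_1)}\cdots p_n^{(\alpha_n)})$ with $w$ a dependent word and $\alpha_1,\dots,\alpha_n\ge 0$ integers whose sum is the length of $w$. Let $T$ and $S$ be tableaux (fillings of a Young diagram) of the same shape $\lambda$ with $\ell$ rows, $T$ with entries in $E$ and $S$ with positive integer entries. Let $w_i\in\mathrm{Super}(L^-)$ be the product, in order, of the entries of the $i$-th row of $T$, and let $q_i\in\mathrm{Super}(P^+)$ be the product over the maximal strings of equal entries in the $i$-th row of $S$ of $p_s^{(k)}$, where $s$ is the repeated entry and $k$ the length of the string. Put $\mathrm{tab}(T|S)=(w_1|q_1)(w_2|q_2)\cdots(w_\ell|q_\ell)$. Theorem. Suppose that $M$ is realizable over $\mathbb{C}$ and that $S$ is column strict (its rows weakly increase and its columns strictly increase). Then the image of $\mathrm{tab}(T|S)$ in $W(M)$ is nonzero if and only if every row of $T$ indexes an independent set of $M$, that is, the entries of each row of $T$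 are distinct and form an independent set of $M$. -/

import Mathlib

namespace Whitney

/-! ### The algebras `Super(L⁻)`, `Super(P⁺)` and `Super(L⁻|P⁺)`

The places `p₁, p₂, …` are indexed by `ℕ+`, the negative letters by a type `E`. -/

/-- `Super(L⁻)`: the exterior algebra of the free `ℤ`-module on the letters. -/
abbrev SuperL (E : Type*) : Type _ := ExteriorAlgebra ℤ (E →₀ ℤ)

/-- The letter `e` as an element of `Super(L⁻)`. -/
noncomputable def letter {E : Type*} (e : E) : SuperL E :=
  ExteriorAlgebra.ι ℤ (Finsupp.single e 1)

/-- The word `e₁ e₂ ⋯ e_k` in `Super(L⁻)`. -/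
noncomputable def letterWord {E : Type*} (w : List E) : SuperL E := (w.map letter).prod

/-- The defining relations of the divided powers; the generator `(p, k)` stands for `p^(k)`. -/
inductive DividedPowerRel : FreeAlgebra ℤ (ℕ+ × ℕ) → FreeAlgebra ℤ (ℕ+ × ℕ) → Prop
  | mul (p : ℕ+) (j k : ℕ) : DividedPowerRel
      (FreeAlgebra.ι ℤ (p, j) * FreeAlgebra.ι ℤ (p, k))
      ((j + k).choose k • FreeAlgebra.ι ℤ (p, j + k))
  | comm (p q : ℕ+) (j k : ℕ) : DividedPowerRel
      (FreeAlgebra.ι ℤ (p, j) * FreeAlgebra.ι ℤ (q, k))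
      (FreeAlgebra.ι ℤ (q, k) * FreeAlgebra.ι ℤ (p, j))
  | zero (p : ℕ+) : DividedPowerRel (FreeAlgebra.ι ℤ (p, 0)) 1

/-- `Super(P⁺)`: the divided power algebra, presented by generators and relations. -/
abbrev SuperP : Type := RingQuot DividedPowerRel

/-- The divided power `p^(k)` in `Super(P⁺)`. -/
noncomputable def divPow (p : ℕ+) (k : ℕ) : SuperP :=
  RingQuot.mkAlgHom ℤ DividedPowerRel (FreeAlgebra.ι ℤ (p, k))

/-- `p^(α) = p₁^(α₁) p₂^(α₂) ⋯ p_n^(α_n)` for `α = (α₁, …, α_n)`. -/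
noncomputable def placeMonomial {n : ℕ} (α : Fin n → ℕ) : SuperP :=
  (List.ofFn fun i : Fin n => divPow i.1.succPNat (α i)).prod

/-- `Super(L⁻|P⁺)`: the exterior algebra of the free `ℤ`-module on the letter-place pairs. -/
abbrev SuperLP (E : Type*) : Type _ := ExteriorAlgebra ℤ ((E × ℕ+) →₀ ℤ)

/-- The letter-place pair `(e|p)`. -/
noncomputable def pair {E : Type*} (e : E) (p : ℕ+) : SuperLP E :=
  ExteriorAlgebra.ι ℤ (Finsupp.single (e, p) 1)

/-! ### The Laplace pairing

A `ℤ`-linear map on `Super(P⁺)` with values in `Super(L⁻|P⁺)` amounts to a power series in the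
places: the coefficient at `α` is the value at `p^(α)`, and the convolution product that
the coproduct of `Super(P⁺)` induces on such maps is the product of power series.  So
`w ↦ (w|·)` is the algebra homomorphism from `Super(L⁻)` to power series that sends the letter
`e` to `∑ₚ (e|p) Xₚ`.  The element `p^(k)` acts on power series by the `k`-th divided derivative,
and `(w|q)` is the constant term of `q` applied to the series of `w`.  The rules that characterize
the pairing are proved below. -/

/-- The linear part (at the exponent `α`) of the series `∑ₚ (v|p) Xₚ`. -/
noncomputable def letterVec (E : Type*) (α : ℕ+ →₀ ℕ) :
    (E →₀ ℤ) →ₗ[ℤ] ((E × ℕ+) →₀ ℤ) :=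
  if α.degree = 1 then ∑ p ∈ α.support, Finsupp.lmapDomain ℤ ℤ (fun e : E => (e, p)) else 0

/-- The series `∑ₚ (v|p) Xₚ`. -/
noncomputable def letterSeries (E : Type*) :
    (E →₀ ℤ) →ₗ[ℤ] MvPowerSeries ℕ+ (SuperLP E) where
  toFun v := fun α => ExteriorAlgebra.ι ℤ (letterVec E α v)
  map_add' v w := by funext α; exact (by simp only [map_add]; rfl)
  map_smul' c v := by funext α; exact (by simp only [map_smul]; rfl)

theorem coeff_letterSeries {E : Type*} (α : ℕ+ →₀ ℕ) (v : E →₀ ℤ) :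
    MvPowerSeries.coeff α (letterSeries E v) = ExteriorAlgebra.ι ℤ (letterVec E α v) := rfl

theorem letterSeries_mul_self {E : Type*} (v : E →₀ ℤ) :
    letterSeries E v * letterSeries E v = 0 := by
  classical
  ext α
  rw [MvPowerSeries.coeff_mul, map_zero]
  refine Finset.sum_involution (fun a _ => a.swap) ?_ ?_ ?_ ?_
  · intro a _
    simp only [coeff_letterSeries, Prod.fst_swap, Prod.snd_swap]
    exact ExteriorAlgebra.ι_add_mul_swap _ _
  · intro a _ h1 h2
    apply h1
    have h3 : a.2 = a.1 := congrArg Prod.fst h2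
    rw [h3, coeff_letterSeries, ExteriorAlgebra.ι_sq_zero]
  · intro a ha
    rw [Finset.HasAntidiagonal.mem_antidiagonal] at ha ⊢
    rw [← ha, Prod.fst_swap, Prod.snd_swap, add_comm]
  · intro a _
    exact Prod.swap_swap a

/-- The algebra homomorphism that sends the letter `e` to `∑ₚ (e|p) Xₚ`. -/
noncomputable def wordSeries (E : Type*) : SuperL E →ₐ[ℤ] MvPowerSeries ℕ+ (SuperLP E) :=
  ExteriorAlgebra.lift ℤ ⟨letterSeries E, letterSeries_mul_self⟩

/-- The `k`-th divided derivative in the variable `p` on power series: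
`X^β ↦ (β_p choose k) X^(β - k p)`. -/
noncomputable def divDeriv (A : Type*) [Ring A] (p : ℕ+) (k : ℕ) :
    Module.End ℤ (MvPowerSeries ℕ+ A) where
  toFun f := fun α => (α p + k).choose k • MvPowerSeries.coeff (α + Finsupp.single p k) f
  map_add' f g := by funext α; exact (by simp only [map_add, smul_add]; rfl)
  map_smul' c f := by
    funext α
    exact smul_comm ((α p + k).choose k) c (MvPowerSeries.coeff (α + Finsupp.single p k) f)

theorem coeff_divDeriv {A : Type*} [Ring A] (p : ℕ+) (k : ℕ) (f : MvPowerSeries ℕ+ A)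
    (α : ℕ+ →₀ ℕ) : MvPowerSeries.coeff α (divDeriv A p k f) =
      (α p + k).choose k • MvPowerSeries.coeff (α + Finsupp.single p k) f := rfl

theorem divDeriv_mul (A : Type*) [Ring A] (p : ℕ+) (j k : ℕ) :
    divDeriv A p j * divDeriv A p k = (j + k).choose k • divDeriv A p (j + k) := by
  refine LinearMap.ext fun f => MvPowerSeries.ext fun α => ?_
  rw [Module.End.mul_apply, LinearMap.smul_apply, map_nsmul, coeff_divDeriv, coeff_divDeriv,
    coeff_divDeriv, smul_smul, smul_smul, add_assoc α, ← Finsupp.single_add]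
  congr 1
  simp only [Finsupp.add_apply, Finsupp.single_eq_same]
  have h := Nat.choose_mul (n := α p + (j + k)) (k := j + k) (s := k) (by omega)
  rw [show α p + (j + k) - k = α p + j by omega, show j + k - k = j by omega] at h
  rw [mul_comm ((j + k).choose k), h, mul_comm, add_assoc]

theorem divDeriv_rel (A : Type*) [Ring A] ⦃x y : FreeAlgebra ℤ (ℕ+ × ℕ)⦄
    (h : DividedPowerRel x y) :
    FreeAlgebra.lift ℤ (fun i : ℕ+ × ℕ => divDeriv A i.1 i.2) x =
      FreeAlgebra.lift ℤ (fun i : ℕ+ × ℕ => divDeriv A i.1 i.2) y := by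
  cases h with
  | mul p j k =>
    simp only [map_mul, map_nsmul, FreeAlgebra.lift_ι_apply, divDeriv_mul]
  | comm p q j k =>
    simp only [map_mul, FreeAlgebra.lift_ι_apply]
    rcases eq_or_ne p q with rfl | hpq
    · rw [divDeriv_mul, divDeriv_mul, add_comm k j, Nat.choose_symm_add]
    · refine LinearMap.ext fun f => MvPowerSeries.ext fun α => ?_
      simp only [Module.End.mul_apply, coeff_divDeriv, smul_smul, add_assoc,
        Finsupp.add_apply, Finsupp.single_eq_of_ne hpq, Finsupp.single_eq_of_ne hpq.symm, zero_add]
      rw [mul_comm, add_comm (Finsupp.single p j)]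
  | zero p =>
    rw [FreeAlgebra.lift_ι_apply, map_one]
    refine LinearMap.ext fun f => MvPowerSeries.ext fun α => ?_
    rw [coeff_divDeriv]
    simp

/-- The action of `Super(P⁺)` on power series by divided derivatives. -/
noncomputable def placeAction (A : Type*) [Ring A] :
    SuperP →ₐ[ℤ] Module.End ℤ (MvPowerSeries ℕ+ A) :=
  RingQuot.liftAlgHom ℤ ⟨FreeAlgebra.lift ℤ fun i : ℕ+ × ℕ => divDeriv A i.1 i.2, divDeriv_rel A⟩

/-- The Laplace pairing `(w|q)` of `w ∈ Super(L⁻)` and `q ∈ Super(P⁺)`. -/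
noncomputable def laplace (E : Type*) : SuperL E →ₗ[ℤ] SuperP →ₗ[ℤ] SuperLP E :=
  LinearMap.mk₂ ℤ
    (fun w q => MvPowerSeries.coeff 0 (placeAction (SuperLP E) q (wordSeries E w)))
    (fun w w' q => by simp only [map_add])
    (fun c w q => by rw [map_zsmul, map_zsmul, map_zsmul])
    (fun w q q' => by simp only [map_add, LinearMap.add_apply])
    (fun c w q => by rw [map_zsmul, LinearMap.smul_apply, map_zsmul])

/-! The rules that characterize the Laplace pairing. -/

/-- The exponent vector of `p^(α)`. -/
noncomputable def placeExponent {n : ℕ} (α : Fin n → ℕ) : ℕ+ →₀ ℕ :=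
  ∑ i : Fin n, Finsupp.single i.1.succPNat (α i)

theorem placeExponent_apply {n : ℕ} (α : Fin n → ℕ) (i : Fin n) :
    placeExponent α i.1.succPNat = α i := by
  classical
  rw [placeExponent, Finsupp.finsetSum_apply, Finset.sum_eq_single i]
  · simp
  · intro j _ hj
    refine Finsupp.single_eq_of_ne fun h => hj (Fin.ext ?_)
    exact (Nat.succPNat_injective h).symm
  · simp

theorem placeExponent_apply_of_ne {n : ℕ} (α : Fin n → ℕ) (p : ℕ+)
    (hp : ∀ i : Fin n, i.1.succPNat ≠ p) : placeExponent α p = 0 := by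
  rw [placeExponent, Finsupp.finsetSum_apply]
  exact Finset.sum_eq_zero fun i _ => Finsupp.single_eq_of_ne (hp i).symm

theorem degree_placeExponent {n : ℕ} (α : Fin n → ℕ) :
    (placeExponent α).degree = ∑ i, α i := by
  simp [placeExponent, map_sum]

theorem placeAction_divPow (A : Type*) [Ring A] (p : ℕ+) (k : ℕ) :
    placeAction A (divPow p k) = divDeriv A p k := by
  rw [placeAction, divPow, RingQuot.liftAlgHom_mkAlgHom_apply, FreeAlgebra.lift_ι_apply]

theorem coeff_placeAction_placeMonomial {A : Type*} [Ring A] (f : MvPowerSeries ℕ+ A) {n : ℕ}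
    (α : Fin n → ℕ) (β : ℕ+ →₀ ℕ) (hβ : ∀ i : Fin n, β i.1.succPNat = 0) :
    MvPowerSeries.coeff β (placeAction A (placeMonomial α) f) =
      MvPowerSeries.coeff (β + placeExponent α) f := by
  induction n generalizing f with
  | zero => simp [placeMonomial, placeExponent]
  | succ n ih =>
    have h1 : placeMonomial α =
        placeMonomial (fun i : Fin n => α i.castSucc) * divPow n.succPNat (α (Fin.last n)) := by
      rw [placeMonomial, List.ofFn_succ', List.concat_eq_append, List.prod_append,
        List.prod_singleton]
      rfl
    have h2 : placeExponent (fun i : Fin n => α i.castSucc) n.succPNat = 0 :=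
      placeExponent_apply_of_ne _ _ fun i h => absurd (Nat.succPNat_injective h) i.2.ne
    have h3 : placeExponent α = placeExponent (fun i : Fin n => α i.castSucc) +
        Finsupp.single n.succPNat (α (Fin.last n)) := by
      simp [placeExponent, Fin.sum_univ_castSucc]
    have h4 := hβ (Fin.last n)
    rw [Fin.val_last] at h4
    rw [h1, map_mul, Module.End.mul_apply, ih _ _ fun i => hβ i.castSucc, placeAction_divPow,
      coeff_divDeriv, Finsupp.add_apply, h2, h4, h3]
    simp [add_assoc]

theorem laplace_placeMonomial {E : Type*} (w : SuperL E) {n : ℕ} (α : Fin n → ℕ) :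
    laplace E w (placeMonomial α) = MvPowerSeries.coeff (placeExponent α) (wordSeries E w) := by
  rw [laplace, LinearMap.mk₂_apply, coeff_placeAction_placeMonomial _ _ _ fun _ => rfl, zero_add]

/-- Rule R1. -/
theorem laplace_one_one (E : Type*) : laplace E 1 1 = 1 := by
  rw [laplace, LinearMap.mk₂_apply, map_one, map_one, Module.End.one_apply,
    MvPowerSeries.coeff_zero_one]

theorem wordSeries_letter {E : Type*} (e : E) :
    wordSeries E (letter e) = letterSeries E (Finsupp.single e 1) := by
  exact ExteriorAlgebra.lift_ι_apply ℤ (letterSeries E) letterSeries_mul_self _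

/-- Rule R2. -/
theorem laplace_letter_divPow_one {E : Type*} (e : E) (p : ℕ+) :
    laplace E (letter e) (divPow p 1) = pair e p := by
  rw [laplace, LinearMap.mk₂_apply, placeAction_divPow, coeff_divDeriv, wordSeries_letter,
    coeff_letterSeries, letterVec, pair]
  simp

/-- Rule R3. -/
theorem laplace_eq_zero_of_degree_ne {E : Type*} (w : List E) {n : ℕ} (α : Fin n → ℕ)
    (h : ∑ i, α i ≠ w.length) : laplace E (letterWord w) (placeMonomial α) = 0 := by
  classical
  rw [laplace_placeMonomial]
  rw [← degree_placeExponent] at h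
  generalize placeExponent α = β at h
  induction w generalizing β with
  | nil =>
    have hβ : β ≠ 0 := by rintro rfl; exact h (map_zero _)
    rw [letterWord, List.map_nil, List.prod_nil, map_one, MvPowerSeries.coeff_one, if_neg hβ]
  | cons e w ih =>
    have hw : letterWord (e :: w) = letter e * letterWord w := by simp [letterWord]
    rw [hw, map_mul, MvPowerSeries.coeff_mul]
    refine Finset.sum_eq_zero fun a ha => ?_
    rw [Finset.HasAntidiagonal.mem_antidiagonal] at ha
    by_cases h1 : a.1.degree = 1
    · rw [ih a.2, mul_zero]
      intro h2
      apply h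
      rw [← ha, map_add, h1, h2, List.length_cons, add_comm]
    · rw [wordSeries_letter, coeff_letterSeries, letterVec, if_neg h1, LinearMap.zero_apply,
        map_zero, zero_mul]

/-- Rule R4, for the coproduct `δ(p^(α)) = ∑_{β + γ = α} p^(β) ⊗ p^(γ)`. -/
theorem laplace_mul {E : Type*} (w w' : SuperL E) {n : ℕ} (α : Fin n → ℕ) :
    laplace E (w * w') (placeMonomial α) =
      ∑ β ∈ Finset.Iic α,
        laplace E w (placeMonomial β) * laplace E w' (placeMonomial (α - β)) := by
  classical
  simp only [laplace_placeMonomial, map_mul, MvPowerSeries.coeff_mul]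
  symm
  refine Finset.sum_bij (fun β _ => (placeExponent β, placeExponent (α - β))) ?_ ?_ ?_ ?_
  · intro β hβ
    rw [Finset.mem_Iic] at hβ
    rw [Finset.HasAntidiagonal.mem_antidiagonal]
    simp only [placeExponent, ← Finset.sum_add_distrib, ← Finsupp.single_add, Pi.sub_apply]
    exact Finset.sum_congr rfl fun i _ => by rw [Nat.add_sub_cancel' (hβ i)]
  · intro β _ γ _ h
    funext i
    rw [← placeExponent_apply β, ← placeExponent_apply γ, show placeExponent β = placeExponent γ from congrArg Prod.fst h]
  · rintro ⟨x, y⟩ h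
    rw [Finset.HasAntidiagonal.mem_antidiagonal] at h
    have hp : ∀ p, x p + y p = placeExponent α p := fun p => by rw [← h]; rfl
    have hi : ∀ i : Fin n, x i.1.succPNat + y i.1.succPNat = α i := fun i => by
      rw [hp, placeExponent_apply]
    refine ⟨fun i => x i.1.succPNat, Finset.mem_Iic.2 fun i => ?_, ?_⟩
    · exact (hi i) ▸ Nat.le_add_right _ _
    · refine Prod.ext (Finsupp.ext fun p => ?_) (Finsupp.ext fun p => ?_)
      all_goals
        by_cases hq : ∃ i : Fin n, i.1.succPNat = p
        · obtain ⟨i, rfl⟩ := hq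
          have := hi i
          simp only [placeExponent_apply, Pi.sub_apply] <;> omega
        · have hq' : ∀ i : Fin n, i.1.succPNat ≠ p := fun i h => hq ⟨i, h⟩
          have := hp p
          rw [placeExponent_apply_of_ne _ _ hq'] at this ⊢
          dsimp only
          omega
  · intro β _
    rfl

/-! ### Tableaux -/

/-- A tableau of shape `μ`: a filling of the boxes of `μ` with elements of `A`.  The box in row `i`
and column `j` (both counted from `0`) is `(i, j)`. -/
abbrev Tableau (A : Type*) (μ : YoungDiagram) : Type _ := {c : ℕ × ℕ // c ∈ μ} → A

/-- The entries of the `i`-th row, in order. -/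
def row {A : Type*} {μ : YoungDiagram} (T : Tableau A μ) (i : ℕ) : List A :=
  List.ofFn fun j : Fin (μ.rowLen i) => T ⟨(i, j.1), YoungDiagram.mem_iff_lt_rowLen.2 j.2⟩

/-- Rows weakly increase and columns strictly increase. -/
def IsColumnStrict {A : Type*} [LinearOrder A] {μ : YoungDiagram} (S : Tableau A μ) : Prop :=
  (∀ c d : {c : ℕ × ℕ // c ∈ μ}, c.1.1 = d.1.1 → c.1.2 < d.1.2 → S c ≤ S d) ∧
  (∀ c d : {c : ℕ × ℕ // c ∈ μ}, c.1.2 = d.1.2 → c.1.1 < d.1.1 → S c < S d)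

/-- Reads a word of places `s` that is preceded by a run of `k` entries equal to `p`; every maximal
run of `k` equal entries `p` contributes the factor `p^(k)`. -/
noncomputable def placeRuns (p : ℕ+) (k : ℕ) : List ℕ+ → SuperP
  | [] => divPow p k
  | s :: l => if s = p then placeRuns p (k + 1) l else divPow p k * placeRuns s 1 l

/-- The element of `Super(P⁺)` of a word of places: the product over its maximal runs of `k` equal
entries `p` of the divided powers `p^(k)`. -/
noncomputable def placeWord : List ℕ+ → SuperP
  | [] => 1
  | s :: l => placeRuns s 1 l

/-- `tab(T|S) = (w₁|q₁)(w₂|q₂) ⋯ (w_ℓ|q_ℓ)` in `Super(L⁻|P⁺)`, where `ℓ`, the length of the first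
column, is the number of rows. -/
noncomputable def tab {E : Type*} {μ : YoungDiagram} (T : Tableau E μ) (S : Tableau ℕ+ μ) :
    SuperLP E :=
  (List.ofFn fun i : Fin (μ.colLen 0) =>
    laplace E (letterWord (row T i)) (placeWord (row S i))).prod

/-! ### The Whitney module of a matroid -/

/-- A word is dependent if the set of its letters is dependent. -/
def IsDependentWord {E : Type*} (M : Matroid E) (w : List E) : Prop := M.Dep {e | e ∈ w}

/-- The elements `(w|p^(α))` for dependent words `w` and (weak) compositions `α` of `|w|`. -/
def whitneyRelators {E : Type*} (M : Matroid E) : Set (SuperLP E) :=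
  {x | ∃ (w : List E) (n : ℕ) (α : Fin n → ℕ), IsDependentWord M w ∧ ∑ i, α i = w.length ∧
    x = laplace E (letterWord w) (placeMonomial α)}

/-- The two-sided ideal that defines the Whitney module. -/
noncomputable def whitneyIdeal {E : Type*} (M : Matroid E) : TwoSidedIdeal (SuperLP E) :=
  TwoSidedIdeal.span (whitneyRelators M)

/-- The Whitney module `W(M)` of a matroid `M` whose ground set is the whole type `E`. -/
abbrev WhitneyModule {E : Type*} (M : Matroid E) : Type _ := (whitneyIdeal M).ringCon.Quotient

/-- The projection of `Super(L⁻|P⁺)` onto `W(M)`. -/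
noncomputable def toWhitneyModule {E : Type*} (M : Matroid E) : SuperLP E →+* WhitneyModule M :=
  (whitneyIdeal M).ringCon.mk'

/-- `M` is realizable over `K`: there is a map from its ground set, which is the whole type `E`, to
a finite-dimensional vector space over `K` such that the independent sets of `M` are those whose
elements index a linearly independent family. -/
def IsRealizable {E : Type*} (K : Type*) [Field K] (M : Matroid E) : Prop :=
  ∃ (d : ℕ) (f : E → Fin d → K), ∀ I : Set E, M.Indep I ↔ LinearIndepOn K f I

/-- The entries of a word are distinct and form an independent set of `M`. -/
def IsIndependentWord {E : Type*} (M : Matroid E) (w : List E) : Prop :=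
  w.Nodup ∧ M.Indep {e | e ∈ w}

end Whitney

/-! A repeated letter makes the word of a row zero, and a row with dependent letters gives a
defining relator of `W(M)`; either way the tableau vanishes in `W(M)`.

Conversely, a realization `f` yields a ring homomorphism `(e|p) ↦ x_e ⊗ p` into an exterior algebra
over the field, where `x_e` lists coordinates of `f e`. It kills the relators, because `(w|q)` goes
to a coefficient of an alternating function of the vectors of `w` (`specialize_eq_zero`). The image
of the tableau must be shown nonzero.

In generic coordinates the vectors of every row have a nonzero leading minor
(`exists_forall_det_ne_zero`). Each row factor is alternating, so row reduction only rescales it,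
and the `j`-th vector of row `i` may be taken to be `e_j` plus terms in coordinates `≥ λ_i`
(`exists_coordWord_echelon`). Now the product of the pairs `(j|S(i,j))` over all boxes has
coefficient 1 (`exists_functional_eq_one`). A term of the expansion consists of a rearrangement `s`
of each row of `S` and a permutation `σ` of the boxes that matches factors with pairs. By the
echelon form, a nonzero term matches each factor with a pair whose column is at least its own; the
total of the columns is fixed, so `σ` preserves columns. Then `s` and `S` have the same sum of
column times entry. The rows of `S` weakly increase, so the equality case of the rearrangement
inequality gives `s = S`. Strictness of the columns forces `σ = 1`. -/

namespace Whitney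

open Finset

/-! ### Words and their contents -/

/-- The content of a word of places, as an exponent vector. -/
noncomputable def content (l : List ℕ+) : ℕ+ →₀ ℕ := Multiset.toFinsupp (l : Multiset ℕ+)

theorem content_nil : content [] = 0 := by
  simp [content]

theorem content_cons (p : ℕ+) (l : List ℕ+) :
    content (p :: l) = Finsupp.single p 1 + content l := by
  rw [content, ← Multiset.cons_coe, ← Multiset.singleton_add, map_add,
    Multiset.toFinsupp_singleton, content]

theorem perm_of_content_eq {l l' : List ℕ+} (h : content l = content l') : l.Perm l' :=
  Multiset.coe_eq_coe.1 (Multiset.toFinsupp.injective h)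

theorem exists_eq_comp_perm_of_content_eq {k : ℕ} {g s : Fin k → ℕ+} (hg : Monotone g)
    (h : content (List.ofFn s) = content (List.ofFn g)) :
    ∃ σ : Equiv.Perm (Fin k), s = g ∘ σ := by
  -- Sorting `s` must give `g`, since a multiset has only one sorted listing.
  refine ⟨(Tuple.sort s)⁻¹, ?_⟩
  have h1 : (List.ofFn (s ∘ Tuple.sort s)).Perm (List.ofFn g) :=
    (Equiv.Perm.ofFn_comp_perm _ _).trans (perm_of_content_eq h)
  have h2 : List.ofFn (s ∘ Tuple.sort s) = List.ofFn g :=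
    h1.eq_of_pairwise (le := (· ≤ ·)) (fun a b _ _ h h' => le_antisymm h h')
      (List.pairwise_ofFn.2 fun _ _ h => Tuple.monotone_sort s h.le)
      (List.pairwise_ofFn.2 fun _ _ h => hg h.le)
  rw [← List.ofFn_injective h2]
  funext i
  simp

theorem sum_mul_le_of_content_eq {k : ℕ} {g s : Fin k → ℕ+} (hg : Monotone g)
    (h : content (List.ofFn s) = content (List.ofFn g)) :
    ∑ j : Fin k, (j : ℕ) * (s j : ℕ) ≤ ∑ j : Fin k, (j : ℕ) * (g j : ℕ) := by
  obtain ⟨σ, rfl⟩ := exists_eq_comp_perm_of_content_eq hg h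
  have hm : Monovary (fun j : Fin k => (j : ℕ)) (fun j => (g j : ℕ)) :=
    Monotone.monovary (fun _ _ h => h) (fun _ _ h => hg h)
  exact hm.sum_mul_comp_perm_le_sum_mul

/-- Equality in the rearrangement inequality forces the rearranged word to be monotone, and the
monotone rearrangement is unique. -/
theorem eq_of_content_eq_of_sum_mul_eq {k : ℕ} {g s : Fin k → ℕ+} (hg : Monotone g)
    (h : content (List.ofFn s) = content (List.ofFn g))
    (h' : ∑ j : Fin k, (j : ℕ) * (s j : ℕ) = ∑ j : Fin k, (j : ℕ) * (g j : ℕ)) : s = g := by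
  obtain ⟨σ, rfl⟩ := exists_eq_comp_perm_of_content_eq hg h
  have hm : Monovary (fun j : Fin k => (j : ℕ)) (fun j => (g j : ℕ)) :=
    Monotone.monovary (fun _ _ h => h) (fun _ _ h => hg h)
  have h1 := hm.sum_mul_comp_perm_eq_sum_mul_iff.1 h'
  have h2 : Monotone (g ∘ σ) := by
    intro a b hab
    rcases hab.eq_or_lt with rfl | hab
    · exact le_rfl
    · by_contra hlt
      exact absurd (h1 (i := b) (j := a) (not_le.1 hlt)) (not_le.2 hab)
  exact Tuple.unique_monotone (τ := 1) h2 hg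

/-! ### The target of the specialization

The letter-place algebra of a vector space with coordinates indexed by `ℕ`. -/

section Target

variable (K : Type*) [Field K]

/-- The exterior algebra of a vector space that contains all `x ⊗ p`, for sequences `x` and
places `p`. -/
abbrev CoordLP : Type _ := ExteriorAlgebra K (ℕ × ℕ+ → K)

/-- The vector `x ⊗ p`. -/
def placeVec (p : ℕ+) : (ℕ → K) →ₗ[K] (ℕ × ℕ+ → K) where
  toFun x c := if p = c.2 then x c.1 else 0
  map_add' x y := by
    funext c
    by_cases h : p = c.2 <;> simp [h]
  map_smul' a x := by
    funext c
    by_cases h : p = c.2 <;> simp [h]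

theorem placeVec_apply (p : ℕ+) (x : ℕ → K) (c : ℕ × ℕ+) :
    placeVec K p x c = if p = c.2 then x c.1 else 0 := rfl

/-- The series `∑_{p ∈ Q} (x ⊗ p) X_p`. -/
noncomputable def coordSeries (Q : Finset ℕ+) :
    (ℕ → K) →ₗ[K] MvPowerSeries ℕ+ (CoordLP K) where
  toFun x := ∑ p ∈ Q, MvPowerSeries.monomial (Finsupp.single p 1)
    (ExteriorAlgebra.ι K (placeVec K p x))
  map_add' x y := by simp only [map_add, sum_add_distrib]
  map_smul' a x := by
    classical
    rw [RingHom.id_apply, smul_sum]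
    refine sum_congr rfl fun p _ => MvPowerSeries.ext fun β => ?_
    change _ = a • MvPowerSeries.coeff β (MvPowerSeries.monomial (Finsupp.single p 1)
      (ExteriorAlgebra.ι K (placeVec K p x)))
    rw [map_smul, map_smul, MvPowerSeries.coeff_monomial, MvPowerSeries.coeff_monomial, smul_ite,
      smul_zero]

theorem coordSeries_apply (Q : Finset ℕ+) (x : ℕ → K) :
    coordSeries K Q x = ∑ p ∈ Q, MvPowerSeries.monomial (Finsupp.single p 1)
      (ExteriorAlgebra.ι K (placeVec K p x)) := rfl

theorem coordSeries_mul_self (Q : Finset ℕ+) (x : ℕ → K) :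
    coordSeries K Q x * coordSeries K Q x = 0 := by
  rw [coordSeries_apply, sum_mul_sum, ← sum_product']
  simp only [MvPowerSeries.monomial_mul_monomial]
  refine sum_involution (fun a _ => a.swap) ?_ ?_ ?_ ?_
  · intro a _
    simp only [Prod.fst_swap, Prod.snd_swap]
    rw [add_comm (Finsupp.single a.2 1), ← map_add, ExteriorAlgebra.ι_add_mul_swap, map_zero]
  · intro a _ h1 h2
    apply h1
    have h3 : a.2 = a.1 := congrArg Prod.fst h2
    rw [h3, ExteriorAlgebra.ι_sq_zero, map_zero]
  · intro a ha
    rw [mem_product] at ha ⊢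
    exact ha.symm
  · intro a _
    exact Prod.swap_swap a

/-- The alternating map `(x₁, …, x_k) ↦ ∏ᵢ ∑_{p ∈ Q} (xᵢ ⊗ p) X_p`. -/
noncomputable def coordWord (Q : Finset ℕ+) (k : ℕ) :
    (ℕ → K) [⋀^Fin k]→ₗ[K] MvPowerSeries ℕ+ (CoordLP K) :=
  (ExteriorAlgebra.lift K ⟨coordSeries K Q, coordSeries_mul_self K Q⟩).toLinearMap.compAlternatingMap
    (ExteriorAlgebra.ιMulti K k)

theorem coordWord_apply (Q : Finset ℕ+) {k : ℕ} (x : Fin k → ℕ → K) :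
    coordWord K Q k x = (List.ofFn fun j => coordSeries K Q (x j)).prod := by
  rw [coordWord, LinearMap.compAlternatingMap_apply, AlgHom.toLinearMap_apply,
    ExteriorAlgebra.ιMulti_apply, map_list_prod, List.map_ofFn]
  congr 2
  funext j
  simp

theorem prod_ofFn_monomial {A : Type*} [Semiring A] {k : ℕ} (s : Fin k → ℕ+) (a : Fin k → A) :
    (List.ofFn fun j => MvPowerSeries.monomial (Finsupp.single (s j) 1) (a j)).prod =
      MvPowerSeries.monomial (content (List.ofFn s)) (List.ofFn a).prod := by
  induction k with
  | zero => simp [content_nil]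
  | succ k ih =>
    rw [List.ofFn_succ, List.prod_cons, ih (fun j => s j.succ) (fun j => a j.succ),
      MvPowerSeries.monomial_mul_monomial, List.ofFn_succ, List.ofFn_succ, content_cons,
      List.prod_cons]

/-- Multiplying out picks one place from `Q` for each letter; the finiteness of `Q` makes this an
ordinary finite expansion. -/
theorem coeff_coordWord (Q : Finset ℕ+) {k : ℕ} (x : Fin k → ℕ → K) (α : ℕ+ →₀ ℕ) :
    MvPowerSeries.coeff α (coordWord K Q k x) =
      ∑ s ∈ (Fintype.piFinset fun _ : Fin k => Q) with α = content (List.ofFn s),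
        (List.ofFn fun j => ExteriorAlgebra.ι K (placeVec K (s j) (x j))).prod := by
  classical
  have h := (MultilinearMap.mkPiAlgebraFin K k (MvPowerSeries ℕ+ (CoordLP K))).map_sum_finset
    (fun j p => MvPowerSeries.monomial (Finsupp.single p 1)
      (ExteriorAlgebra.ι K (placeVec K p (x j)))) (fun _ => Q)
  simp only [MultilinearMap.mkPiAlgebraFin_apply, prod_ofFn_monomial] at h
  rw [coordWord_apply]
  simp only [coordSeries_apply]
  rw [h, map_sum, sum_filter]
  exact sum_congr rfl fun s _ => MvPowerSeries.coeff_monomial _ _ _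

/-- The coefficient of a product of pairs `(j|p)`, as a linear functional. -/
noncomputable def pairsCoeff {n : ℕ} (c : Fin n → ℕ × ℕ+) : CoordLP K →ₗ[K] K :=
  ExteriorAlgebra.liftAlternating fun i =>
    -- Only the component of degree `n` contributes; there the functional is the minor in the
    -- columns `c`.
    if h : i = n then
      (Matrix.detRowAlternating (n := Fin i) (R := K)).compLinearMap
        (LinearMap.funLeft K K fun k => c (Fin.cast h k))
    else 0

theorem pairsCoeff_prod {n : ℕ} (c : Fin n → ℕ × ℕ+) (y : Fin n → ℕ × ℕ+ → K) :
    pairsCoeff K c (List.ofFn fun k => ExteriorAlgebra.ι K (y k)).prod =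
      (Matrix.of fun k k' => y k (c k')).det := by
  rw [← ExteriorAlgebra.ιMulti_apply, pairsCoeff, ExteriorAlgebra.liftAlternating_apply_ιMulti,
    dif_pos rfl]
  rfl

end Target

/-! ### Nonvanishing of column strict tableaux in echelon form -/

section Boxes

variable {ℓ : ℕ} (lam : Fin ℓ → ℕ)

/-- The boxes of an array with rows of lengths `lam i`, in reading order. -/
def boxList : List (Σ i, Fin (lam i)) :=
  (List.ofFn fun i => List.ofFn fun j => (⟨i, j⟩ : Σ i, Fin (lam i))).flatten

theorem nodup_boxList : (boxList lam).Nodup := by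
  rw [boxList, List.nodup_flatten]
  constructor
  · intro l hl
    obtain ⟨i, rfl⟩ := (List.mem_ofFn' _ _).1 hl
    exact List.nodup_ofFn.2 fun a b h => by simpa using h
  · rw [List.pairwise_ofFn]
    intro a b hab c hc hc'
    obtain ⟨j, rfl⟩ := (List.mem_ofFn' _ _).1 hc
    obtain ⟨j', h⟩ := (List.mem_ofFn' _ _).1 hc'
    exact hab.ne (congrArg Sigma.fst h).symm

/-- The `k`-th box in reading order. -/
def box (k : Fin (boxList lam).length) : Σ i, Fin (lam i) := (boxList lam).get k

theorem box_injective : Function.Injective (box lam) :=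
  List.nodup_iff_injective_get.1 (nodup_boxList lam)

theorem prod_ofFn_box {A : Type*} [Monoid A] (f : (Σ i, Fin (lam i)) → A) :
    (List.ofFn fun k => f (box lam k)).prod =
      (List.ofFn fun i => (List.ofFn fun j => f ⟨i, j⟩).prod).prod := by
  have h : (List.ofFn fun k => f (box lam k)) = (boxList lam).map f := by
    rw [← List.ofFn_get ((boxList lam).map f)]
    refine List.ext_get (by simp) fun n h1 h2 => ?_
    simp [box]
  rw [h, boxList, List.map_flatten, List.prod_flatten, List.map_map, List.map_ofFn]
  congr 2
  funext i
  simp [List.map_ofFn, Function.comp_def]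

theorem sum_box {A : Type*} [AddCommMonoid A] (f : (Σ i, Fin (lam i)) → A) :
    ∑ k, f (box lam k) = ∑ i, ∑ j, f ⟨i, j⟩ := by
  -- The additive statement is the multiplicative one read in `Multiplicative A`.
  have h := prod_ofFn_box (A := Multiplicative A) lam (fun b => Multiplicative.ofAdd (f b))
  simp only [List.prod_ofFn] at h
  exact h

end Boxes

section Echelon

variable {K : Type*} [Field K] {ℓ : ℕ} {lam : Fin ℓ → ℕ} {S s : ∀ i, Fin (lam i) → ℕ+}
  {x : ∀ i, Fin (lam i) → ℕ → K}

/-- The combinatorial core: only the identity matching of the unrearranged tableau contributes to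
the chosen coefficient. -/
theorem eq_one_of_forall_ne_zero (hS : ∀ i, Monotone (S i))
    (hcol : ∀ b b' : Σ i, Fin (lam i), (b.2 : ℕ) = b'.2 → S b.1 b.2 = S b'.1 b'.2 → b = b')
    (hx : ∀ i j (j' : ℕ), j' < lam i → x i j j' = if j' = j then 1 else 0)
    (hs : ∀ i, content (List.ofFn (s i)) = content (List.ofFn (S i)))
    (σ : Equiv.Perm (Fin (boxList lam).length))
    (hσ : ∀ k, placeVec K (s (box lam (σ k)).1 (box lam (σ k)).2)
      (x (box lam (σ k)).1 (box lam (σ k)).2)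
      ((box lam k).2, S (box lam k).1 (box lam k).2) ≠ 0) : s = S ∧ σ = 1 := by
  have h1 : ∀ k, s (box lam (σ k)).1 (box lam (σ k)).2 = S (box lam k).1 (box lam k).2 := by
    intro k
    by_contra h
    exact hσ k (by rw [placeVec_apply, if_neg h])
  -- A smaller column on the right would lie within the row length of box `σ k`, where the echelon
  -- form has a zero.
  have h2 : ∀ k, ((box lam (σ k)).2 : ℕ) ≤ (box lam k).2 := by
    intro k
    have h := hσ k
    rw [placeVec_apply, if_pos (h1 k)] at h
    by_contra! hlt
    refine h ?_
    dsimp only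
    rw [hx _ _ _ (hlt.trans (box lam (σ k)).2.2), if_neg hlt.ne]
  -- Both sides have the same sum over `k`, so the termwise inequalities are equalities.
  have h3 : ∀ k, ((box lam (σ k)).2 : ℕ) = (box lam k).2 := by
    have := (sum_eq_sum_iff_of_le fun k (_ : k ∈ univ) => h2 k).1
      (Equiv.sum_comp σ fun k => ((box lam k).2 : ℕ))
    exact fun k => this k (mem_univ k)
  have h4 : ∑ k, ((box lam k).2 : ℕ) * (s (box lam k).1 (box lam k).2 : ℕ) =
      ∑ k, ((box lam k).2 : ℕ) * (S (box lam k).1 (box lam k).2 : ℕ) := by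
    rw [← Equiv.sum_comp σ]
    exact sum_congr rfl fun k _ => by rw [h1, h3]
  rw [sum_box lam fun b => (b.2 : ℕ) * (s b.1 b.2 : ℕ),
    sum_box lam fun b => (b.2 : ℕ) * (S b.1 b.2 : ℕ)] at h4
  have h5 : s = S := by
    funext i
    refine eq_of_content_eq_of_sum_mul_eq (hS i) (hs i) ?_
    -- The rearrangement inequality holds row by row, so equality of the totals gives equality in
    -- each row.
    exact (sum_eq_sum_iff_of_le fun i (_ : i ∈ univ) =>
      sum_mul_le_of_content_eq (hS i) (hs i)).1 h4 i (mem_univ i)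
  subst h5
  exact ⟨rfl, Equiv.ext fun k => box_injective lam (hcol _ _ (h3 k) (h1 k))⟩

theorem exists_functional_eq_one (hS : ∀ i, Monotone (S i))
    (hcol : ∀ b b' : Σ i, Fin (lam i), (b.2 : ℕ) = b'.2 → S b.1 b.2 = S b'.1 b'.2 → b = b')
    (hx : ∀ i j (j' : ℕ), j' < lam i → x i j j' = if j' = j then 1 else 0)
    (Q : Finset ℕ+) (hQ : ∀ i j, S i j ∈ Q) :
    ∃ F : CoordLP K →ₗ[K] K, F (List.ofFn fun i => MvPowerSeries.coeff
      (content (List.ofFn (S i))) (coordWord K Q (lam i) (x i))).prod = 1 := by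
  classical
  refine ⟨pairsCoeff K fun k => ((box lam k).2, S (box lam k).1 (box lam k).2), ?_⟩
  simp only [coeff_coordWord]
  have h := (MultilinearMap.mkPiAlgebraFin K ℓ (CoordLP K)).map_sum_finset
    (fun i (s : Fin (lam i) → ℕ+) =>
      (List.ofFn fun j => ExteriorAlgebra.ι K (placeVec K (s j) (x i j))).prod)
    (fun i => {s ∈ Fintype.piFinset fun _ : Fin (lam i) => Q |
      content (List.ofFn (S i)) = content (List.ofFn s)})
  simp only [MultilinearMap.mkPiAlgebraFin_apply] at h
  rw [h, map_sum]
  have h1 : ∀ s : ∀ i, Fin (lam i) → ℕ+, (List.ofFn fun i =>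
      (List.ofFn fun j => ExteriorAlgebra.ι K (placeVec K (s i j) (x i j))).prod).prod =
      (List.ofFn fun k => ExteriorAlgebra.ι K (placeVec K (s (box lam k).1 (box lam k).2)
        (x (box lam k).1 (box lam k).2))).prod := fun s =>
    (prod_ofFn_box lam fun b => ExteriorAlgebra.ι K (placeVec K (s b.1 b.2) (x b.1 b.2))).symm
  simp only [h1, pairsCoeff_prod, Matrix.det_apply, Matrix.of_apply]
  have h2 : ∀ s : ∀ i, Fin (lam i) → ℕ+,
      (∀ i, content (List.ofFn (S i)) = content (List.ofFn (s i))) →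
      ∀ σ : Equiv.Perm (Fin (boxList lam).length), ¬ (s = S ∧ σ = 1) →
      ∏ k, placeVec K (s (box lam (σ k)).1 (box lam (σ k)).2)
        (x (box lam (σ k)).1 (box lam (σ k)).2)
        ((box lam k).2, S (box lam k).1 (box lam k).2) = 0 := by
    intro s hs σ hne
    by_contra h0
    exact hne (eq_one_of_forall_ne_zero hS hcol hx (fun i => (hs i).symm) σ
      fun k => prod_ne_zero_iff.1 h0 k (mem_univ k))
  rw [sum_eq_single S, sum_eq_single 1]
  · rw [Equiv.Perm.sign_one, one_smul]
    refine prod_eq_one fun k _ => ?_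
    simp only [Equiv.Perm.one_apply]
    rw [placeVec_apply, if_pos rfl, hx _ _ _ (box lam k).2.2, if_pos rfl]
  · intro σ _ hσ
    rw [h2 S (fun _ => rfl) σ fun h => hσ h.2, smul_zero]
  · simp
  · intro s hs hne
    refine sum_eq_zero fun σ _ => ?_
    rw [h2 s (fun i => ?_) σ fun h => hne h.1, smul_zero]
    exact (mem_filter.1 (Fintype.mem_piFinset.1 hs i)).2
  · intro hn
    simp only [Fintype.mem_piFinset, mem_filter] at hn
    exact absurd (fun i => ⟨hQ i, trivial⟩) hn

end Echelon

/-! ### Generic coordinates -/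

section Generic

variable {K : Type*} [Field K]

theorem exists_mul_eq_one_of_linearIndependent_row {m n : Type*} [Fintype m] [Fintype n]
    [DecidableEq m] [DecidableEq n] {A : Matrix m n K} (h : LinearIndependent K A.row) :
    ∃ B : Matrix n m K, A * B = 1 := by
  obtain ⟨g, hg⟩ := LinearMap.exists_leftInverse_of_injective (Matrix.toLinearMapRight' A)
    (LinearMap.ker_eq_bot.2 (Matrix.vecMul_injective_iff.2 h))
  refine ⟨LinearMap.toMatrixRight' g, Matrix.toLinearMapRight'.injective ?_⟩
  rw [Matrix.toLinearMapRight'_mul, Matrix.toLinearMapRight'_one, ← hg]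
  congr 1
  exact LinearMap.toMatrixRight'.symm_apply_apply g

/-- Finitely many independent families have simultaneous coordinates in which all their leading
minors are nonzero. -/
theorem exists_forall_det_ne_zero [Infinite K] {ι : Type*} [Fintype ι] {d : ℕ} (lam : ι → ℕ)
    (f : ∀ i, Matrix (Fin (lam i)) (Fin d) K) (hf : ∀ i, LinearIndependent K (f i).row) :
    ∃ g : ℕ → Fin d → K, ∀ i,
      (Matrix.of fun j j' : Fin (lam i) => ∑ k, f i j k * g j' k).det ≠ 0 := by
  -- The unknown coordinate functionals become polynomial variables. Each minor is a nonzero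
  -- polynomial, since a right inverse of `f i` gives it the value 1; over an infinite field the
  -- product of the minors has a nonvanishing point.
  let P : ι → MvPolynomial (ℕ × Fin d) K := fun i =>
    (Matrix.of fun j j' : Fin (lam i) =>
      ∑ k, MvPolynomial.C (f i j k) * MvPolynomial.X ((j' : ℕ), k)).det
  have heval : ∀ (y : ℕ × Fin d → K) i, MvPolynomial.eval y (P i) =
      (Matrix.of fun j j' : Fin (lam i) => ∑ k, f i j k * y ((j' : ℕ), k)).det := by
    intro y i
    rw [RingHom.map_det]
    congr 1
    ext j j'
    simp
  have hP : ∀ i, P i ≠ 0 := by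
    intro i h0
    obtain ⟨B, hB⟩ := exists_mul_eq_one_of_linearIndependent_row (hf i)
    have h := heval (fun c => if hc : c.1 < lam i then B c.2 ⟨c.1, hc⟩ else 0) i
    rw [h0, map_zero] at h
    have h1 : (Matrix.of fun j j' : Fin (lam i) => ∑ k, f i j k *
        (if hc : (j' : ℕ) < lam i then B k ⟨j', hc⟩ else 0)) = 1 := by
      rw [← hB]
      ext j j'
      simp [Matrix.mul_apply]
    rw [h1, Matrix.det_one] at h
    exact zero_ne_one h
  have hprod : ∏ i, P i ≠ 0 := prod_ne_zero_iff.2 fun i _ => hP i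
  obtain ⟨y, hy⟩ : ∃ y, MvPolynomial.eval y (∏ i, P i) ≠ 0 := by
    by_contra! hall
    exact hprod (MvPolynomial.funext fun y => by rw [hall, map_zero])
  refine ⟨fun j k => y (j, k), fun i => ?_⟩
  rw [map_prod] at hy
  rw [← heval]
  exact prod_ne_zero_iff.1 hy i (mem_univ i)

/-- Both sides are alternating in the rows of `A`, so they need only be compared on permutations of
the standard basis, hence on the identity matrix. -/
theorem alternatingMap_sum_smul {M N : Type*} [AddCommGroup M] [Module K M] [AddCommGroup N]
    [Module K N] {k : ℕ} (f : M [⋀^Fin k]→ₗ[K] N) (A : Matrix (Fin k) (Fin k) K) (v : Fin k → M) :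
    f (fun j => ∑ m, A j m • v m) = A.det • f v := by
  have h : f.compLinearMap (Fintype.linearCombination K v) =
      (LinearMap.toSpanSingleton K N (f v)).compAlternatingMap Matrix.detRowAlternating := by
    refine Module.Basis.ext_alternating (Pi.basisFun K (Fin k)) fun w hw => ?_
    obtain ⟨σ, rfl⟩ : ∃ σ : Equiv.Perm (Fin k), w = σ :=
      ⟨Equiv.ofBijective w (Finite.injective_iff_bijective.1 hw), rfl⟩
    have h1 := AlternatingMap.map_perm (f.compLinearMap (Fintype.linearCombination K v))
      (Pi.basisFun K (Fin k)) σ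
    have h2 := AlternatingMap.map_perm ((LinearMap.toSpanSingleton K N (f v)).compAlternatingMap
      Matrix.detRowAlternating) (Pi.basisFun K (Fin k)) σ
    refine h1.trans (Eq.trans ?_ h2.symm)
    congr 1
    have h3 : Matrix.detRowAlternating (fun i => Pi.basisFun K (Fin k) i) = (1 : K) := by
      rw [← Matrix.det_one (n := Fin k) (R := K)]
      change Matrix.det _ = _
      congr 1
      ext i j
      simp [Matrix.one_apply, Pi.single_apply, eq_comm]
    rw [LinearMap.compAlternatingMap_apply, h3, LinearMap.toSpanSingleton_apply, one_smul,
      AlternatingMap.compLinearMap_apply]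
    congr 1
    funext i
    simp [Fintype.linearCombination_apply_single]
  exact DFunLike.congr_fun h A

/-- Row reduction by the inverse of the leading block; coordinates from `k` on remain arbitrary. -/
theorem exists_coordWord_echelon (Q : Finset ℕ+) {k : ℕ} (v : Fin k → ℕ → K)
    (hv : (Matrix.of fun j j' : Fin k => v j j').det ≠ 0) :
    ∃ (c : K) (b : Fin k → ℕ → K), coordWord K Q k b = c • coordWord K Q k v ∧
      ∀ (j : Fin k) (j' : ℕ), j' < k → b j j' = if j' = j then 1 else 0 := by
  set A := Matrix.of fun j j' : Fin k => v j j' with hA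
  refine ⟨A⁻¹.det, fun j => ∑ m, A⁻¹ j m • v m, alternatingMap_sum_smul _ _ _, fun j j' hj' => ?_⟩
  have h := congrFun (congrFun (Matrix.nonsing_inv_mul A (Ne.isUnit hv)) j) ⟨j', hj'⟩
  rw [Matrix.mul_apply, Matrix.one_apply] at h
  simp only [Finset.sum_apply, Pi.smul_apply, smul_eq_mul]
  refine Eq.trans h (if_congr ?_ rfl rfl)
  rw [Fin.ext_iff, eq_comm]

end Generic

/-! ### The specialization -/

section Specialize

variable {K : Type*} [Field K] {E : Type*} (Q : Finset ℕ+) (x : E → ℕ → K)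

/-- The linear map `(e|p) ↦ x_e ⊗ p` for `p ∈ Q`, and `(e|p) ↦ 0` for the other places. -/
noncomputable def specializeLinear : ((E × ℕ+) →₀ ℤ) →ₗ[ℤ] CoordLP K :=
  (ExteriorAlgebra.ι K).toAddMonoidHom.toIntLinearMap ∘ₗ
    Finsupp.linearCombination ℤ fun c : E × ℕ+ =>
      if c.2 ∈ Q then placeVec K c.2 (x c.1) else 0

/-- The ring homomorphism `(e|p) ↦ x_e ⊗ p` for `p ∈ Q`, and `(e|p) ↦ 0` for the other places. -/
noncomputable def specialize : SuperLP E →+* CoordLP K :=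
  (ExteriorAlgebra.lift ℤ ⟨specializeLinear Q x, fun _ => ExteriorAlgebra.ι_sq_zero _⟩).toRingHom

theorem specialize_pair (e : E) (p : ℕ+) : specialize Q x (pair e p) =
    if p ∈ Q then ExteriorAlgebra.ι K (placeVec K p (x e)) else 0 := by
  have h : specialize Q x (pair e p) = specializeLinear Q x (Finsupp.single (e, p) 1) :=
    ExteriorAlgebra.lift_ι_apply ℤ _ _ _
  rw [h, specializeLinear, LinearMap.comp_apply, Finsupp.linearCombination_single, one_smul]
  by_cases hp : p ∈ Q
  · simp [hp]
  · simp [hp]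

theorem map_specialize_letter (e : E) :
    MvPowerSeries.map (specialize Q x) (wordSeries E (letter e)) = coordSeries K Q (x e) := by
  classical
  ext β
  rw [MvPowerSeries.coeff_map, wordSeries_letter, coeff_letterSeries, letterVec,
    coordSeries_apply, map_sum]
  simp only [MvPowerSeries.coeff_monomial]
  by_cases hβ : β.degree = 1
  · obtain ⟨p, rfl⟩ := (Finsupp.sum_eq_one_iff β).1 hβ
    have h1 : ExteriorAlgebra.ι ℤ ((if (Finsupp.single p 1).degree = 1 then
        ∑ q ∈ (Finsupp.single p 1).support, Finsupp.lmapDomain ℤ ℤ (fun e : E => (e, q)) else 0)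
          (Finsupp.single e 1)) = pair e p := by
      rw [if_pos hβ, Finsupp.support_single p one_ne_zero, sum_singleton,
        Finsupp.lmapDomain_apply, Finsupp.mapDomain_single, pair]
    rw [h1, specialize_pair]
    simp [Finsupp.single_left_inj]
  · rw [if_neg hβ, LinearMap.zero_apply, map_zero, map_zero]
    refine (sum_eq_zero fun p _ => if_neg ?_).symm
    rintro rfl
    exact hβ (by simp)

theorem map_specialize_letterWord {k : ℕ} (w : Fin k → E) :
    MvPowerSeries.map (specialize Q x) (wordSeries E (letterWord (List.ofFn w))) =
      coordWord K Q k fun j => x (w j) := by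
  rw [letterWord, List.map_ofFn, map_list_prod, map_list_prod, List.map_ofFn, List.map_ofFn,
    coordWord_apply]
  congr 2
  funext j
  exact map_specialize_letter Q x (w j)

end Specialize

/-! ### Words of places -/

/-- In a sorted word a place does not recur after its run, so each divided derivative meets exponent
0 in its own variable and its binomial coefficient is 1. -/
theorem coeff_placeAction_placeRuns {A : Type*} [Ring A] (l : List ℕ+) (p : ℕ+) (k : ℕ)
    (hl : (p :: l).SortedLE) (f : MvPowerSeries ℕ+ A) (β : ℕ+ →₀ ℕ)
    (hβ : ∀ q ∈ p :: l, β q = 0) :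
    MvPowerSeries.coeff β (placeAction A (placeRuns p k l) f) =
      MvPowerSeries.coeff (β + (Finsupp.single p k + content l)) f := by
  induction l generalizing p k β f with
  | nil =>
    rw [placeRuns, placeAction_divPow, coeff_divDeriv, hβ p (by simp), content_nil]
    simp
  | cons s l ih =>
    rw [placeRuns, content_cons]
    have hl' := hl.pairwise
    rw [List.pairwise_cons] at hl'
    split_ifs with h
    · subst h
      rw [ih s (k + 1) hl'.2.sortedLE f β fun q hq => hβ q (List.mem_cons_of_mem _ hq),
        Finsupp.single_add]
      simp only [add_assoc]
    · have hps : ∀ q ∈ s :: l, p ≠ q := by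
        have h1 : p < s := lt_of_le_of_ne (hl'.1 s (by simp)) (Ne.symm h)
        intro q hq
        rcases List.mem_cons.1 hq with rfl | hq'
        · exact h1.ne
        · exact (h1.trans_le ((List.pairwise_cons.1 hl'.2).1 q hq')).ne
      rw [map_mul, Module.End.mul_apply, placeAction_divPow, coeff_divDeriv, hβ p (by simp),
        zero_add, Nat.choose_self, one_smul, ih s 1 hl'.2.sortedLE f]
      · simp only [add_assoc]
      · intro q hq
        rw [Finsupp.add_apply, hβ q (List.mem_cons_of_mem _ hq),
          Finsupp.single_eq_of_ne (hps q hq).symm, add_zero]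

theorem laplace_placeWord {E : Type*} (w : SuperL E) (l : List ℕ+) (hl : l.SortedLE) :
    laplace E w (placeWord l) = MvPowerSeries.coeff (content l) (wordSeries E w) := by
  rw [laplace, LinearMap.mk₂_apply]
  cases l with
  | nil => simp [placeWord, content_nil]
  | cons p l =>
    rw [placeWord, coeff_placeAction_placeRuns l p 1 hl _ _ fun _ _ => rfl, zero_add,
      content_cons]

theorem exists_placeExponent_eq (γ : ℕ+ →₀ ℕ) :
    ∃ (n : ℕ) (α : Fin n → ℕ), placeExponent α = γ := by
  -- The number of variables is the largest place in the support, or 0 if `γ = 0`.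
  refine ⟨γ.support.sup fun p : ℕ+ => (p : ℕ), fun i => γ i.1.succPNat, Finsupp.ext fun p => ?_⟩
  by_cases h : ∃ i : Fin (γ.support.sup fun p : ℕ+ => (p : ℕ)), i.1.succPNat = p
  · obtain ⟨i, rfl⟩ := h
    rw [placeExponent_apply]
  · rw [placeExponent_apply_of_ne _ _ fun i hi => h ⟨i, hi⟩]
    by_contra hne
    refine h ⟨⟨p.natPred, ?_⟩, p.succPNat_natPred⟩
    have h1 := le_sup (f := fun p : ℕ+ => (p : ℕ)) (Finsupp.mem_support_iff.2 (Ne.symm hne))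
    exact lt_of_lt_of_le (by rw [← p.natPred_add_one]; exact Nat.lt_succ_self _) h1

theorem degree_content (l : List ℕ+) : (content l).degree = l.length := by
  induction l with
  | nil => simp [content_nil]
  | cons p l ih => rw [content_cons, map_add, ih, Finsupp.degree_single, List.length_cons, add_comm]

theorem letterWord_eq_zero {E : Type*} {w : List E} (h : ¬ w.Nodup) : letterWord w = 0 := by
  have h1 : letterWord w = ExteriorAlgebra.ιMulti ℤ w.length
      fun i => Finsupp.single (w.get i) (1 : ℤ) := by
    rw [ExteriorAlgebra.ιMulti_apply, letterWord]
    congr 1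
    conv_lhs => rw [← List.ofFn_get w, List.map_ofFn]
    rfl
  rw [List.nodup_iff_injective_get] at h
  simp only [Function.Injective, not_forall] at h
  obtain ⟨i, j, hij, hne⟩ := h
  rw [h1]
  exact AlternatingMap.map_eq_zero_of_eq _ _ (by rw [hij]) hne

/-! ### The Whitney module -/

section Module

variable {E : Type*} {M : Matroid E}

theorem toWhitneyModule_eq_zero_iff {z : SuperLP E} :
    toWhitneyModule M z = 0 ↔ z ∈ whitneyIdeal M := by
  conv_rhs => rw [← TwoSidedIdeal.ker_ringCon_mk' (whitneyIdeal M), TwoSidedIdeal.mem_ker]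
  rfl

theorem toWhitneyModule_laplace_eq_zero (hE : M.E = Set.univ) {w : List E} {l : List ℕ+}
    (hl : l.SortedLE) (hlen : l.length = w.length) (hw : ¬ IsIndependentWord M w) :
    toWhitneyModule M (laplace E (letterWord w) (placeWord l)) = 0 := by
  by_cases hn : w.Nodup
  · have hd : IsDependentWord M w := by
      rw [IsDependentWord, Matroid.Dep, hE]
      exact ⟨fun hi => hw ⟨hn, hi⟩, Set.subset_univ _⟩
    obtain ⟨n, α, hα⟩ := exists_placeExponent_eq (content l)
    rw [toWhitneyModule_eq_zero_iff]
    refine TwoSidedIdeal.subset_span ⟨w, n, α, hd, ?_, ?_⟩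
    · rw [← degree_placeExponent, hα, degree_content, hlen]
    · rw [laplace_placeWord _ _ hl, laplace_placeMonomial, hα]
  · rw [letterWord_eq_zero hn, map_zero, LinearMap.zero_apply, map_zero]

theorem specialize_eq_zero {K : Type*} [Field K] (Q : Finset ℕ+) (x : E → ℕ → K)
    (hx : ∀ I : Set E, LinearIndepOn K x I → M.Indep I) {z : SuperLP E}
    (hz : z ∈ whitneyIdeal M) : specialize Q x z = 0 := by
  rw [← TwoSidedIdeal.mem_ker]
  refine TwoSidedIdeal.span_le.2 ?_ hz
  rintro _ ⟨w, n, α, hw, -, rfl⟩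
  rw [SetLike.mem_coe, TwoSidedIdeal.mem_ker, laplace_placeMonomial, ← MvPowerSeries.coeff_map]
  conv_lhs => rw [← List.ofFn_get w, map_specialize_letterWord]
  rw [AlternatingMap.map_linearDependent, map_zero]
  intro hli
  -- A linearly independent family has no repeated letter, so independence of the family passes to
  -- its set of letters.
  refine hw.not_indep (hx _ ?_)
  have hinj : Function.Injective w.get := fun a b hab => hli.injective (congrArg x hab)
  have h := (linearIndepOn_range_iff hinj x).2 hli
  rwa [Set.range_list_get] at h

end Module

end Whitney

/-! ### The nonvanishing criterion -/

theorem mainTheorem3 {E : Type*} [Finite E] (M : Matroid E) (hE : M.E = Set.univ)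
    (hM : Whitney.IsRealizable ℂ M) (μ : YoungDiagram)
    (T : Whitney.Tableau E μ) (S : Whitney.Tableau ℕ+ μ) (hS : Whitney.IsColumnStrict S) :
    Whitney.toWhitneyModule M (Whitney.tab T S) ≠ 0 ↔
      ∀ i < μ.colLen 0, Whitney.IsIndependentWord M (Whitney.row T i) := by
  open Whitney in
  have hmono : ∀ i : ℕ, Monotone fun j : Fin (μ.rowLen i) =>
      S ⟨(i, j.1), YoungDiagram.mem_iff_lt_rowLen.2 j.2⟩ := by
    intro i a b hab
    rcases hab.eq_or_lt with rfl | hab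
    · exact le_rfl
    · exact hS.1 _ _ rfl hab
  have hsorted : ∀ i, (row S i).SortedLE := fun i =>
    (List.pairwise_ofFn.2 fun _ _ h => hmono i h.le).sortedLE
  constructor
  · intro h i hi
    by_contra hw
    refine h ?_
    rw [tab, map_list_prod]
    refine List.prod_eq_zero (List.mem_map.2 ⟨_, (List.mem_ofFn' _ _).2 ⟨⟨i, hi⟩, rfl⟩, ?_⟩)
    exact toWhitneyModule_laplace_eq_zero hE (hsorted i) (by simp [row]) hw
  · intro hT hzero
    rw [toWhitneyModule_eq_zero_iff] at hzero
    obtain ⟨d, f, hf⟩ := hM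
    let t : ∀ i : Fin (μ.colLen 0), Fin (μ.rowLen i) → E := fun i j =>
      T ⟨(i.1, j.1), YoungDiagram.mem_iff_lt_rowLen.2 j.2⟩
    let s : ∀ i : Fin (μ.colLen 0), Fin (μ.rowLen i) → ℕ+ := fun i j =>
      S ⟨(i.1, j.1), YoungDiagram.mem_iff_lt_rowLen.2 j.2⟩
    have hli : ∀ i, LinearIndependent ℂ (Matrix.of fun j => f (t i j)).row := by
      intro i
      obtain ⟨hnd, hind⟩ := hT i i.2
      have h1 : {e | e ∈ row T i} = Set.range (t i) := Set.ext fun e => List.mem_ofFn' _ _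
      rw [h1, hf] at hind
      exact (linearIndepOn_range_iff (List.nodup_ofFn.1 hnd) f).1 hind
    obtain ⟨g, hg⟩ := exists_forall_det_ne_zero (fun i : Fin (μ.colLen 0) => μ.rowLen i)
      (fun i => Matrix.of fun j => f (t i j)) hli
    let G : (Fin d → ℂ) →ₗ[ℂ] (ℕ → ℂ) := LinearMap.pi fun j => ∑ k, g j k • LinearMap.proj k
    have hG : ∀ y j, G y j = ∑ k, y k * g j k := by
      intro y j
      simp [G, mul_comm]
    -- The places that occur in `S` suffice; all others are sent to zero.
    let Q : Finset ℕ+ := Finset.univ.image fun a : Σ i, Fin (μ.rowLen (i : Fin (μ.colLen 0))) => s a.1 a.2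
    -- `G` need not be injective: independence of the images under a linear map already implies
    -- independence.
    have hzero' := specialize_eq_zero Q (fun e => G (f e))
      (fun I hI => (hf I).2 (LinearIndependent.of_comp G hI)) hzero
    have hb : ∀ i : Fin (μ.colLen 0), ∃ (c : ℂ) (b : Fin (μ.rowLen i) → ℕ → ℂ),
        coordWord ℂ Q _ b = c • coordWord ℂ Q _ (fun j => G (f (t i j))) ∧
        ∀ (j : Fin (μ.rowLen i)) (j' : ℕ), j' < μ.rowLen i → b j j' = if j' = j then 1 else 0 := by
      intro i
      refine exists_coordWord_echelon Q _ ?_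
      convert hg i using 4
      exact funext fun _ => hG _ _
    choose c b hcb hbe using hb
    have hcol : ∀ b b' : Σ i : Fin (μ.colLen 0), Fin (μ.rowLen i), (b.2 : ℕ) = b'.2 →
        s b.1 b.2 = s b'.1 b'.2 → b = b' := by
      rintro ⟨i, j, hj⟩ ⟨i', j', hj'⟩ hjj hs
      dsimp only at hjj
      subst hjj
      have : i = i' := by
        rcases lt_trichotomy i i' with h | h | h
        · exact absurd hs (hS.2 ⟨(i.1, j), _⟩ ⟨(i'.1, j), _⟩ rfl h).ne
        · exact h
        · exact absurd hs (hS.2 ⟨(i'.1, j), _⟩ ⟨(i.1, j), _⟩ rfl h).ne'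
      subst this
      rfl
    obtain ⟨F, hF⟩ := exists_functional_eq_one (K := ℂ) (S := s) (x := b)
      (fun i => hmono i) hcol hbe Q fun i j =>
        Finset.mem_image.2 ⟨⟨i, j⟩, Finset.mem_univ _, rfl⟩
    -- The product of the row factors is multilinear, so the scalars from the row reductions collect
    -- in front.
    have h1 : (List.ofFn fun i : Fin (μ.colLen 0) => MvPowerSeries.coeff
        (content (List.ofFn (s i))) (coordWord ℂ Q (μ.rowLen i) (b i))).prod =
        (∏ i, c i) • specialize Q (fun e => G (f e)) (tab T S) := by
      rw [tab, map_list_prod, List.map_ofFn, ← MultilinearMap.mkPiAlgebraFin_apply (R := ℂ),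
        ← MultilinearMap.mkPiAlgebraFin_apply (R := ℂ), ← MultilinearMap.map_smul_univ]
      congr 1
      funext i
      rw [hcb, Function.comp_apply, laplace_placeWord _ _ (hsorted i),
        ← MvPowerSeries.coeff_map]
      have h2 : coordWord ℂ Q _ (fun j => G (f (t i j))) = MvPowerSeries.map
          (specialize Q fun e => G (f e)) (wordSeries E (letterWord (row T i))) :=
        (map_specialize_letterWord Q (fun e => G (f e)) (t i)).symm
      rw [h2]
      rfl
    rw [h1, hzero', smul_zero, map_zero] at hF
    exact zero_ne_one hF
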